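/- Let $\mathcal A$ be a (not necessarily unital) $C^*$-algebra and $E$ a Hilbert $C^*$-module over $\mathcal A$. For a densely defined operator $T$ in $E$, the adjoint $T^*$ is given by $y\in\operatorname{dom}T^*$, $T^*y=z$ iff $\langle Tx,y\rangle=\langle x,z\rangle$ for all $x\in\operatorname{dom}T$; $T$ is selfadjoint if $T=T^*$. An operator $T$ is semiregular if it is defined on a dense $\mathcal A$-submodule and $T^*$ is densely defined; it is regular if it is moreover closed and $I+T^*T$ has dense range. Let $S$ and $T$ be selfadjoint regular operators in $E$, and assume that there is a dense $\mathcal A$-submodule $\mathcal E\subset E$ such that 1. $\mathcal E\subset\operatorname{dom}(T)$ is a core for $T$; 2. $(S-i\mu)^{-1}\xi\in\operatorname{dom}(S)\cap\operatorname{dom}(T)$ and $T(S-i\mu)^{-1}\xi\in\operatorname{dom}(S)$ for all $\mu\in\mathbb R\setminus\{0\}$ and all $\xi\in\mathcal E$; 3. for every $\mu\in\mathbb R\setminus\{0\}$ the map $[S,T](S-i\mu)^{-1}:\mathcal E\to E$ extends to a bounded $\mathcal A$-linear operator $X_\mu:E\to E$, where $[S,T]=ST-TS$ on its natural domain. Then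 the operators $S+iT$ and $S-iT$ with domain $\operatorname{dom}(S)\cap\operatorname{dom}(T)$ are semiregular (in particular densely defined), closed, and adjoints of each other: $$(S+iT)^*=S-iT,\qquad (S-iT)^*=S+iT .$$ Moreover, the operator $$D=\begin{pmatrix}0&S-iT\\ S+iT&0\end{pmatrix},\qquad \operatorname{dom}(D)=\bigl(\operatorname{dom}(S)\cap\operatorname{dom}(T)\bigr)^2\subset E\oplus E,$$ is selfadjoint. -/

import Mathlib

open scoped CStarAlgebra ComplexOrder WithCStarModule

namespace HilbertModuleOp

section Composition

variable {E : Type*} [AddCommGroup E] [Module ℂ E]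

/-- The composition `g ∘ f` of partially defined operators on its natural domain
`{x ∈ dom f | f x ∈ dom g}`. -/
noncomputable def pcomp (g f : E →ₗ.[ℂ] E) : E →ₗ.[ℂ] E :=
  g.comp (f.domRestrict ((g.domain.comap f.toFun).map f.domain.subtype)) (by
    rintro ⟨x, hx⟩
    obtain ⟨⟨y, hy, rfl⟩, hx₂⟩ := hx
    exact hy)

theorem mem_pcomp_domain {g f : E →ₗ.[ℂ] E} {x : E} :
    x ∈ (pcomp g f).domain ↔ ∃ h : x ∈ f.domain, f ⟨x, h⟩ ∈ g.domain := by
  constructor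
  · rintro ⟨⟨y, hy, rfl⟩, _⟩
    exact ⟨y.2, hy⟩
  · rintro ⟨h, hg⟩
    exact ⟨⟨⟨x, h⟩, hg, rfl⟩, h⟩

theorem pcomp_apply {g f : E →ₗ.[ℂ] E} {x : E} (h : x ∈ f.domain) (hg : f ⟨x, h⟩ ∈ g.domain) :
    pcomp g f ⟨x, mem_pcomp_domain.2 ⟨h, hg⟩⟩ = g ⟨f ⟨x, h⟩, hg⟩ := rfl

/-- The identity operator, with domain the whole space. -/
def idOp (E : Type*) [AddCommGroup E] [Module ℂ E] : E →ₗ.[ℂ] E :=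
  (LinearMap.id : E →ₗ[ℂ] E).toPMap ⊤

/-- The commutator `[S, T] = S T - T S`, on its natural domain `dom (S T) ∩ dom (T S)`. -/
noncomputable def commutator (S T : E →ₗ.[ℂ] E) : E →ₗ.[ℂ] E :=
  pcomp S T - pcomp T S

/-- The resolvent `(S - i μ)⁻¹`, as the inverse of the partially defined operator `S - i μ`;
its domain is the range of `S - i μ`. -/
noncomputable def resolvent (S : E →ₗ.[ℂ] E) (μ : ℝ) : E →ₗ.[ℂ] E :=
  (S - (Complex.I * (μ : ℂ)) • idOp E).inverse

end Composition

section Module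

variable (A : Type*) [NonUnitalCStarAlgebra A] [PartialOrder A] [StarOrderedRing A]
variable {E : Type*} [NormedAddCommGroup E] [NormedSpace ℂ E] [SMul A E] [CStarModule A E]

/-- The pairs `(y, z)` with `⟨T x, y⟩ = ⟨x, z⟩` for all `x ∈ dom T`. -/
def adjointGraph (T : E →ₗ.[ℂ] E) : Submodule ℂ (E × E) where
  carrier := {p | ∀ x : T.domain, inner A (T x) p.1 = inner A (x : E) p.2}
  add_mem' := by
    intro p q hp hq x
    simp [hp x, hq x]
  zero_mem' := by
    intro x
    simp [CStarModule.inner_zero_right]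
  smul_mem' := by
    intro c p hp x
    simp [hp x]

/-- The adjoint `T*` of a densely defined operator `T` in a Hilbert `C*`-module: `y ∈ dom T*` iff
there is a `z` with `⟨T x, y⟩ = ⟨x, z⟩` for all `x ∈ dom T`, and then `T* y = z`. -/
noncomputable def adjoint (T : E →ₗ.[ℂ] E) : E →ₗ.[ℂ] E :=
  (adjointGraph A T).toLinearPMap

/-- For a densely defined operator, the graph of the adjoint is `adjointGraph`. -/
theorem adjoint_graph {T : E →ₗ.[ℂ] E} (hT : Dense (T.domain : Set E)) :
    (adjoint A T).graph = adjointGraph A T := by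
  refine Submodule.toLinearPMap_graph_eq _ ?_
  rintro ⟨y, z⟩ h hy
  have hy' : y = 0 := hy
  subst hy'
  have h0 : ∀ x : E, inner A x z = 0 := by
    intro x
    have hcl : IsClosed {x : E | inner A x z = 0} :=
      isClosed_eq
        ((CStarModule.continuous_inner (A := A) (E := E)).comp (Continuous.prodMk_left z))
        continuous_const
    refine hT.induction (P := fun x => inner A x z = 0) ?_ hcl x
    intro w hw
    have := h ⟨w, hw⟩
    simpa [CStarModule.inner_zero_right] using this.symm
  exact CStarModule.inner_self.1 (h0 z)

/-- `T` is semiregular: it is defined on a dense `A`-submodule, and its adjoint is densely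
defined. -/
structure IsSemiregular (T : E →ₗ.[ℂ] E) : Prop where
  smul_mem : ∀ (a : A) (x : E), x ∈ T.domain → a • x ∈ T.domain
  dense_domain : Dense (T.domain : Set E)
  dense_adjoint_domain : Dense ((adjoint A T).domain : Set E)

/-- `T` is regular: closed, semiregular, and `I + T* T` has dense range. -/
structure IsRegular (T : E →ₗ.[ℂ] E) : Prop extends IsSemiregular A T where
  isClosed : T.IsClosed
  dense_range : Dense (Set.range (idOp E + pcomp (adjoint A T) T))

/-- `T` is densely defined and `T* = T`, with equality of domains. -/
structure IsSelfAdjoint (T : E →ₗ.[ℂ] E) : Prop where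
  dense_domain : Dense (T.domain : Set E)
  adjoint_eq : adjoint A T = T

/-- For selfadjoint `S` and real `μ ≠ 0`, the value `η = (S - i μ)⁻¹ ξ` is the unique solution
`η ∈ dom S` of `S η - i μ η = ξ`. -/
theorem mem_resolvent_graph {S : E →ₗ.[ℂ] E} (hS : IsSelfAdjoint A S) {μ : ℝ} (hμ : μ ≠ 0)
    (ξ η : E) :
    (ξ, η) ∈ (resolvent S μ).graph ↔
      ∃ h : η ∈ S.domain, S ⟨η, h⟩ - (Complex.I * (μ : ℂ)) • η = ξ := by
  have hker : (S - (Complex.I * (μ : ℂ)) • idOp E).toFun.ker = ⊥ := by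
    rw [LinearMap.ker_eq_bot']
    rintro ⟨x, hx, hx'⟩ h
    have hSx : S ⟨x, hx⟩ = (Complex.I * (μ : ℂ)) • x := sub_eq_zero.1 h
    have hg : (x, S ⟨x, hx⟩) ∈ adjointGraph A S := by
      rw [← adjoint_graph A hS.dense_domain, hS.adjoint_eq]
      exact S.mem_graph ⟨x, hx⟩
    have h1 : inner A (S ⟨x, hx⟩) x = inner A x (S ⟨x, hx⟩) := hg ⟨x, hx⟩
    rw [hSx, CStarModule.inner_smul_left_complex, CStarModule.inner_smul_right_complex,
      ← sub_eq_zero, ← sub_smul, smul_eq_zero] at h1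
    have h2 : inner A x x = 0 := by
      refine h1.resolve_left fun h3 => hμ ?_
      have := congrArg Complex.im h3
      simp at this
      linarith
    exact Subtype.ext (CStarModule.inner_self.1 h2)
  rw [resolvent, LinearPMap.inverse_graph hker]
  simp only [Submodule.mem_map, LinearPMap.mem_graph_iff]
  constructor
  · rintro ⟨p, ⟨⟨y, hy⟩, h1, h2⟩, h3⟩
    obtain ⟨h4, h5⟩ := Prod.mk.inj h3
    have h6 : y = η := h1.trans h5
    subst h6
    exact ⟨hy.1, h2.trans h4⟩
  · rintro ⟨h, h'⟩
    exact ⟨(η, ξ), ⟨⟨η, h, trivial⟩, rfl, h'⟩, rfl⟩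

/-- The standing assumption on the pair `S, T`: `𝓔` is a dense `A`-submodule which is a core
for `T`; for all real `μ ≠ 0` and `ξ ∈ 𝓔` one has `(S - i μ)⁻¹ ξ ∈ dom S ∩ dom T` and
`T (S - i μ)⁻¹ ξ ∈ dom S`; and `[S, T] (S - i μ)⁻¹ : 𝓔 → E` extends to a bounded `A`-linear
operator on `E`. (For `S` selfadjoint and regular, `(S - i μ)⁻¹` is defined on all of `E`.) -/
structure CommutatorAssumption (S T : E →ₗ.[ℂ] E) (𝓔 : Submodule ℂ E) : Prop where
  smul_mem : ∀ (a : A) (ξ : E), ξ ∈ 𝓔 → a • ξ ∈ 𝓔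
  dense : Dense (𝓔 : Set E)
  hasCore : T.HasCore 𝓔
  resolvent_mem : ∀ μ : ℝ, μ ≠ 0 → ∀ ξ : (resolvent S μ).domain, (ξ : E) ∈ 𝓔 →
    resolvent S μ ξ ∈ S.domain ∧
      ∃ h : resolvent S μ ξ ∈ T.domain, T ⟨resolvent S μ ξ, h⟩ ∈ S.domain
  exists_bounded_extension : ∀ μ : ℝ, μ ≠ 0 → ∃ X : E →L[ℂ] E,
    (∀ (a : A) (ξ : E), X (a • ξ) = a • X ξ) ∧
    (pcomp (commutator S T) (resolvent S μ)).domRestrict 𝓔 ≤ (X : E →ₗ[ℂ] E).toPMap ⊤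

end Module

section Matrix

variable (A : Type*) {E : Type*} [NormedAddCommGroup E] [NormedSpace ℂ E]

/-- The operator matrix `(0 P; Q 0)` in the Hilbert `C*`-module `E ⊕ E`, with domain
`dom Q ⊕ dom P`, acting by `(x₁, x₂) ↦ (P x₂, Q x₁)`. -/
noncomputable def offDiagonal (P Q : E →ₗ.[ℂ] E) :
    C⋆ᵐᵒᵈ(A, E × E) →ₗ.[ℂ] C⋆ᵐᵒᵈ(A, E × E) where
  domain := (Q.domain.prod P.domain).comap
    (WithCStarModule.linearEquiv ℂ A (E × E) : C⋆ᵐᵒᵈ(A, E × E) →ₗ[ℂ] E × E)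
  toFun :=
    { toFun := fun x => (WithCStarModule.equiv A (E × E)).symm
        (P ⟨(x : C⋆ᵐᵒᵈ(A, E × E)).2, x.2.2⟩, Q ⟨(x : C⋆ᵐᵒᵈ(A, E × E)).1, x.2.1⟩)
      map_add' := fun x y => congrArg (WithCStarModule.equiv A (E × E)).symm
        (Prod.ext (P.toFun.map_add ⟨_, x.2.2⟩ ⟨_, y.2.2⟩)
          (Q.toFun.map_add ⟨_, x.2.1⟩ ⟨_, y.2.1⟩))
      map_smul' := fun c x => congrArg (WithCStarModule.equiv A (E × E)).symm
        (Prod.ext (P.toFun.map_smul c ⟨_, x.2.2⟩) (Q.toFun.map_smul c ⟨_, x.2.1⟩)) }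

/-- The sum operator `D = (0 S-iT; S+iT 0)` in `E ⊕ E`, with domain `(dom S ∩ dom T)²`. -/
noncomputable def sumOperator (S T : E →ₗ.[ℂ] E) :
    C⋆ᵐᵒᵈ(A, E × E) →ₗ.[ℂ] C⋆ᵐᵒᵈ(A, E × E) :=
  offDiagonal A (S - Complex.I • T) (S + Complex.I • T)

theorem mem_sumOperator_domain {S T : E →ₗ.[ℂ] E} {x : C⋆ᵐᵒᵈ(A, E × E)} :
    x ∈ (sumOperator A S T).domain ↔
      (x.1 ∈ S.domain ∧ x.1 ∈ T.domain) ∧ (x.2 ∈ S.domain ∧ x.2 ∈ T.domain) :=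
  Iff.rfl

end Matrix

end HilbertModuleOp

/-! Write `R μ` for `(S - iμ)⁻¹`, which regularity makes bounded and everywhere defined. The
hypotheses say that on `𝓔`, hence on `dom T` by the core property, `T (R μ) x = R μ (T x + X μ x)`.
The resolvent identity gives `X ν = X μ (1 + i(ν - μ) R ν)`, so `X ν → 0` strongly as `|ν| → ∞`
(`IsCommutatorFamily.tendsto_zero`). Hence the mollifiers `-iν R ν → 1` asymptotically commute with
`T`.

Closedness: mollifying yields `⟨Sx, Tx⟩ - ⟨Tx, Sx⟩ = ⟨x, X μ (S - iμ) x⟩` on `dom S ∩ dom T`. The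
commutator is thus first order in `S`, and `‖Sx‖` is controlled by `‖(S ± iT)x‖` and `‖x‖`
(`IsCommutatorFamily.norm_le`).

Adjoints: if `y ∈ dom (S + iT)*`, testing against `R (-ρ) x` puts `R ρ y` in `dom T`. Then `-iρ R ρ
y` converges to `y` in the graph norm of `S - iT`, which is closed. Selfadjointness of `D` follows
by transposing the matrix. -/

namespace HilbertModuleOp

open Filter Topology Complex

/-! ### Selfadjoint operators: closedness and the lower bound for `S - iμ` -/

section SelfAdjoint

variable {A : Type*} [NonUnitalCStarAlgebra A] [PartialOrder A] [StarOrderedRing A]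
variable {E : Type*} [NormedAddCommGroup E] [NormedSpace ℂ E] [SMul A E] [CStarModule A E]
variable {S : E →ₗ.[ℂ] E}

omit [StarOrderedRing A] in
theorem mem_adjointGraph_iff {T : E →ₗ.[ℂ] E} {y z : E} :
    (y, z) ∈ adjointGraph A T ↔ ∀ x t, (x, t) ∈ T.graph → inner A t y = inner A x z := by
  constructor
  · intro h x t hx
    obtain ⟨w, rfl, rfl⟩ := (LinearPMap.mem_graph_iff T).1 hx
    exact h w
  · intro h w
    exact h _ _ (T.mem_graph w)

theorem IsSelfAdjoint.mem_graph_iff (hS : IsSelfAdjoint A S) {y z : E} :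
    (y, z) ∈ S.graph ↔ ∀ x t, (x, t) ∈ S.graph → inner A t y = inner A x z := by
  rw [← mem_adjointGraph_iff, ← adjoint_graph A hS.dense_domain, hS.adjoint_eq]

theorem IsSelfAdjoint.symm (hS : IsSelfAdjoint A S) {x s y t : E} (hx : (x, s) ∈ S.graph)
    (hy : (y, t) ∈ S.graph) : inner A s y = inner A x t :=
  hS.mem_graph_iff.1 hy _ _ hx

theorem isClosed_adjointGraph (T : E →ₗ.[ℂ] E) :
    IsClosed (adjointGraph A T : Set (E × E)) := by
  have : (adjointGraph A T : Set (E × E)) =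
      ⋂ x : T.domain, {p : E × E | inner A (T x) p.1 = inner A (x : E) p.2} := by
    ext p
    simp only [Set.mem_iInter]
    rfl
  rw [this]
  refine isClosed_iInter fun x => isClosed_eq ?_ ?_
  · exact CStarModule.continuous_inner.comp (continuous_const.prodMk continuous_fst)
  · exact CStarModule.continuous_inner.comp (continuous_const.prodMk continuous_snd)

theorem isClosed_adjoint {T : E →ₗ.[ℂ] E} (hT : Dense (T.domain : Set E)) :
    (adjoint A T).IsClosed := by
  rw [LinearPMap.IsClosed, adjoint_graph A hT]
  exact isClosed_adjointGraph T

theorem IsSelfAdjoint.isClosed (hS : IsSelfAdjoint A S) : S.IsClosed :=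
  hS.adjoint_eq ▸ isClosed_adjoint hS.dense_domain

variable (A) in
include A in
theorem norm_le_of_inner_self_add {f x y : E}
    (h : inner A f f = inner A x x + inner A y y) : ‖x‖ ≤ ‖f‖ := by
  have h1 : ‖inner A x x‖ ≤ ‖inner A f f‖ :=
    CStarAlgebra.norm_le_norm_of_nonneg_of_le CStarModule.inner_self_nonneg
      (h ▸ le_add_of_nonneg_right CStarModule.inner_self_nonneg)
  rw [← CStarModule.norm_sq_eq, ← CStarModule.norm_sq_eq] at h1
  exact (sq_le_sq₀ (norm_nonneg _) (norm_nonneg _)).1 h1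

/-- Symmetry cancels the cross terms in `⟨(S - iμ)x, (S - iμ)x⟩`, leaving `μ²⟨x, x⟩ + ⟨Sx, Sx⟩`, and
the norm is monotone on positive elements of `A`. -/
theorem IsSelfAdjoint.norm_le (hS : IsSelfAdjoint A S) {x s : E} (hx : (x, s) ∈ S.graph) (μ : ℝ) :
    |μ| * ‖x‖ ≤ ‖s - (I * μ) • x‖ := by
  have h : inner A (s - (I * μ) • x) (s - (I * μ) • x) =
      inner A ((μ : ℂ) • x) ((μ : ℂ) • x) + inner A s s := by
    simp only [CStarModule.inner_sub_left, CStarModule.inner_sub_right,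
      CStarModule.inner_smul_left_complex, CStarModule.inner_smul_right_complex, hS.symm hx hx,
      smul_smul]
    simp only [star_mul', RCLike.star_def, conj_I, conj_ofReal]
    linear_combination (norm := module) -((μ : ℂ) ^ 2 * I_mul_I) • inner A x x
  simpa [norm_smul] using norm_le_of_inner_self_add A h

/-- The operators `R μ` are everywhere defined right inverses of `S - i μ`. -/
def IsResolventFamily (S : E →ₗ.[ℂ] E) (R : ℝ → E →L[ℂ] E) : Prop :=
  ∀ μ : ℝ, μ ≠ 0 → ∀ x, (R μ x, x + (I * μ) • R μ x) ∈ S.graph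

/-! ### Resolvent identities and strong limits as `|ν| → ∞` -/

section Family

variable {R : ℝ → E →L[ℂ] E}

theorem IsResolventFamily.eq_of_mem_graph (hR : IsResolventFamily S R) (hS : IsSelfAdjoint A S)
    {μ : ℝ} (hμ : μ ≠ 0) {x s : E} (hx : (x, s) ∈ S.graph) : R μ (s - (I * μ) • x) = x := by
  have hsub : (R μ (s - (I * μ) • x) - x,
      s - (I * μ) • x + (I * μ) • R μ (s - (I * μ) • x) - s) ∈ S.graph :=
    S.graph.sub_mem (hR μ hμ (s - (I * μ) • x)) hx
  have h := hS.norm_le hsub μ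
  have h0 : (s - (I * μ) • x + (I * μ) • R μ (s - (I * μ) • x) - s) -
      (I * μ) • (R μ (s - (I * μ) • x) - x) = 0 := by module
  rw [h0, norm_zero] at h
  have h2 : 0 < |μ| := abs_pos.2 hμ
  have h3 : ‖R μ (s - (I * μ) • x) - x‖ ≤ 0 := by
    by_contra h4
    exact absurd h (not_le.2 (mul_pos h2 (not_le.1 h4)))
  exact sub_eq_zero.1 (norm_le_zero_iff.1 h3)

theorem IsResolventFamily.injective (hR : IsResolventFamily S R) {μ : ℝ} (hμ : μ ≠ 0) :
    Function.Injective (R μ) := by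
  refine (injective_iff_map_eq_zero _).2 fun x hx => ?_
  have h := hR μ hμ x
  rw [hx, smul_zero, add_zero] at h
  exact S.graph_fst_eq_zero_snd h rfl

theorem IsResolventFamily.norm_le (hR : IsResolventFamily S R) (hS : IsSelfAdjoint A S)
    {μ : ℝ} (hμ : μ ≠ 0) (x : E) : |μ| * ‖R μ x‖ ≤ ‖x‖ := by
  simpa using hS.norm_le (hR μ hμ x) μ

theorem IsResolventFamily.inner_eq (hR : IsResolventFamily S R) (hS : IsSelfAdjoint A S)
    {μ : ℝ} (hμ : μ ≠ 0) (x y : E) : inner A (R μ x) y = inner A x (R (-μ) y) := by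
  have h := hS.symm (hR μ hμ x) (hR (-μ) (neg_ne_zero.2 hμ) y)
  simp only [CStarModule.inner_add_left, CStarModule.inner_add_right,
      CStarModule.inner_smul_left_complex, CStarModule.inner_smul_right_complex] at h
  simp only [star_mul', RCLike.star_def, conj_I, conj_ofReal, ofReal_neg] at h
  linear_combination (norm := module) -h

/-- The resolvent identity: the argument of `R μ` is `(S - iμ) R ν x`. -/
theorem IsResolventFamily.apply_add (hR : IsResolventFamily S R) (hS : IsSelfAdjoint A S)
    {μ ν : ℝ} (hμ : μ ≠ 0) (hν : ν ≠ 0) (x : E) :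
    R μ (x + (I * (ν - μ)) • R ν x) = R ν x := by
  rw [← hR.eq_of_mem_graph hS hμ (hR ν hν x)]
  congr 1
  rw [hR.eq_of_mem_graph hS hμ (hR ν hν x)]
  module

theorem IsResolventFamily.apply_eq (hR : IsResolventFamily S R) (hS : IsSelfAdjoint A S)
    {μ ν : ℝ} (hμ : μ ≠ 0) (hν : ν ≠ 0) (x : E) :
    R ν x = R μ x + (I * (ν - μ)) • R μ (R ν x) := by
  simpa using (hR.apply_add hS hμ hν x).symm

theorem IsResolventFamily.dense_image (hR : IsResolventFamily S R) (hS : IsSelfAdjoint A S)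
    {μ : ℝ} (hμ : μ ≠ 0) {D : Set E} (hD : Dense D) : Dense (R μ '' D) := by
  have hr : DenseRange (R μ) := by
    refine hS.dense_domain.mono ?_
    intro x hx
    exact ⟨_, hR.eq_of_mem_graph hS hμ (S.mem_graph ⟨x, hx⟩)⟩
  exact hr.dense_image (R μ).continuous hD

theorem IsResolventFamily.norm_smul_le (hR : IsResolventFamily S R) (hS : IsSelfAdjoint A S)
    {ν : ℝ} (hν : ν ≠ 0) (x : E) : ‖(I * ν) • R ν x‖ ≤ ‖x‖ := by
  simpa [norm_smul] using hR.norm_le hS hν x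

theorem eventually_cobounded_ne_zero : ∀ᶠ ν in Bornology.cobounded ℝ, ν ≠ 0 := by
  filter_upwards [eventually_cobounded_le_norm (E := ℝ) 1] with ν h h0
  norm_num [h0] at h

theorem IsResolventFamily.tendsto_zero (hR : IsResolventFamily S R) (hS : IsSelfAdjoint A S)
    (x : E) : Tendsto (fun ν => R ν x) (Bornology.cobounded ℝ) (𝓝 0) := by
  have h : Tendsto (fun ν : ℝ => ‖ν‖⁻¹ * ‖x‖) (Bornology.cobounded ℝ) (𝓝 0) := by
    simpa using (tendsto_norm_cobounded_atTop (E := ℝ)).inv_tendsto_atTop.mul_const ‖x‖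
  refine squeeze_zero_norm' ?_ h
  filter_upwards [eventually_cobounded_ne_zero] with ν hν
  rw [le_inv_mul_iff₀ (norm_pos_iff.2 hν)]
  exact hR.norm_le hS hν x

/-- The expression is `S (R ν) x`. For `w ∈ dom S` it equals `R ν (S w) → 0`; since `iν R ν` is a
contraction, density of `dom S` gives the rest. -/
theorem IsResolventFamily.tendsto_add (hR : IsResolventFamily S R) (hS : IsSelfAdjoint A S)
    (x : E) : Tendsto (fun ν : ℝ => x + (I * ν) • R ν x) (Bornology.cobounded ℝ) (𝓝 0) := by
  rw [Metric.tendsto_nhds]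
  intro ε hε
  obtain ⟨w, hw, hxw⟩ := Metric.mem_closure_iff.1 (hS.dense_domain x) (ε / 4) (by positivity)
  have h1 := (Metric.tendsto_nhds.1 (hR.tendsto_zero hS (S ⟨w, hw⟩))) (ε / 4) (by positivity)
  filter_upwards [h1, eventually_cobounded_ne_zero] with ν h2 hν
  rw [dist_zero_right] at h2 ⊢
  rw [dist_eq_norm] at hxw
  have h3 : R ν (S ⟨w, hw⟩) = w + (I * ν) • R ν w := by
    have := hR.eq_of_mem_graph hS hν (S.mem_graph ⟨w, hw⟩)
    rw [map_sub, map_smul] at this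
    exact sub_eq_iff_eq_add.1 this
  have h4 : x + (I * ν) • R ν x =
      (x - w) + ((I * ν) • R ν (x - w) + R ν (S ⟨w, hw⟩)) := by
    rw [h3, map_sub]
    module
  rw [h4]
  calc _ ≤ ‖x - w‖ + (‖(I * ν) • R ν (x - w)‖ + ‖R ν (S ⟨w, hw⟩)‖) :=
        (norm_add_le _ _).trans (by gcongr; exact norm_add_le _ _)
    _ ≤ ε / 4 + (ε / 4 + ε / 4) := by
        have := hR.norm_smul_le hS hν (x - w)
        gcongr
        exact this.trans hxw.le
    _ < ε := by linarith

/-- These are the mollifiers: they map `E` into `dom S` and tend strongly to the identity. -/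
theorem IsResolventFamily.tendsto_smul (hR : IsResolventFamily S R) (hS : IsSelfAdjoint A S)
    (x : E) : Tendsto (fun ν : ℝ => (-(I * ν)) • R ν x) (Bornology.cobounded ℝ) (𝓝 x) := by
  have h := (hR.tendsto_add hS x).const_sub x
  rw [sub_zero] at h
  refine h.congr fun ν => ?_
  module

theorem IsResolventFamily.tendsto_smul_apply_zero (hR : IsResolventFamily S R)
    (hS : IsSelfAdjoint A S) {f : ℝ → E} (hf : Tendsto f (Bornology.cobounded ℝ) (𝓝 0)) :
    Tendsto (fun ν : ℝ => (I * ν) • R ν (f ν)) (Bornology.cobounded ℝ) (𝓝 0) := by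
  refine squeeze_zero_norm' ?_ (tendsto_zero_iff_norm_tendsto_zero.1 hf)
  filter_upwards [eventually_cobounded_ne_zero] with ν hν
  exact hR.norm_smul_le hS hν _

end Family

/-! ### Existence of the resolvents from regularity -/

section Existence

variable [CompleteSpace E]

/-- `S - i μ` is surjective. -/
def IsSurjectiveAt (S : E →ₗ.[ℂ] E) (μ : ℝ) : Prop :=
  ∀ y, ∃ x s, (x, s) ∈ S.graph ∧ s - (I * μ) • x = y

omit [CompleteSpace E] in
theorem IsSelfAdjoint.exists_rightInverse (hS : IsSelfAdjoint A S) {μ : ℝ} (hμ : μ ≠ 0)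
    (h : IsSurjectiveAt S μ) :
    ∃ R : E →L[ℂ] E, (∀ x, (R x, x + (I * μ) • R x) ∈ S.graph) ∧ ∀ x, |μ| * ‖R x‖ ≤ ‖x‖ := by
  have hinj : ∀ {x s y t : E}, (x, s) ∈ S.graph → (y, t) ∈ S.graph →
      s - (I * μ) • x = t - (I * μ) • y → x = y := by
    intro x s y t hx hy hxy
    have hxy' : (x - y, s - t) ∈ S.graph := S.graph.sub_mem hx hy
    have h1 := hS.norm_le hxy' μ
    rw [show s - t - (I * μ) • (x - y) = 0 by
      linear_combination (norm := module) hxy, norm_zero] at h1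
    by_contra hne
    exact absurd h1 (not_le.2 (mul_pos (abs_pos.2 hμ) (norm_pos_iff.2 (sub_ne_zero.2 hne))))
  choose f g hfg hf using h
  have hg : ∀ y, g y = y + (I * μ) • f y := fun y => sub_eq_iff_eq_add.1 (hf y)
  let L : E →ₗ[ℂ] E :=
    { toFun := f
      map_add' := fun x y => hinj (hfg _) (S.graph.add_mem (hfg x) (hfg y)) (by
        change g (x + y) - (I * μ) • f (x + y) = (g x + g y) - (I * μ) • (f x + f y)
        rw [hg, hg, hg]; module)
      map_smul' := fun c x => hinj (hfg _) (S.graph.smul_mem c (hfg x)) (by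
        change g (c • x) - (I * μ) • f (c • x) = (c • g x) - (I * μ) • (c • f x)
        rw [hg, hg]; module) }
  have hL : ∀ x, |μ| * ‖L x‖ ≤ ‖x‖ := fun x => by
    have := hS.norm_le (hfg x) μ
    rwa [hf] at this
  refine ⟨L.mkContinuous |μ|⁻¹ fun x => ?_, fun x => ?_, hL⟩
  · rw [le_inv_mul_iff₀ (abs_pos.2 hμ)]
    exact hL x
  · have := hfg x
    rwa [hg] at this

/-- Neumann series: `(S - iν) R = 1 - i(ν - μ) R` with `‖R‖ ≤ 1/|μ|`, so the right side is
invertible. -/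
theorem IsSelfAdjoint.isSurjectiveAt_of_abs_sub_lt (hS : IsSelfAdjoint A S) {μ ν : ℝ} (hμ : μ ≠ 0)
    (h : IsSurjectiveAt S μ) (hν : |ν - μ| < |μ|) : IsSurjectiveAt S ν := by
  obtain ⟨R, hR, hRn⟩ := hS.exists_rightInverse hμ h
  have hn : ‖(I * (ν - μ)) • R‖ < 1 := by
    have h1 : ‖R‖ ≤ |μ|⁻¹ := R.opNorm_le_bound (by positivity) fun x => by
      rw [le_inv_mul_iff₀ (abs_pos.2 hμ)]
      exact hRn x
    calc ‖(I * (ν - μ)) • R‖ = |ν - μ| * ‖R‖ := by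
          rw [norm_smul, norm_mul, norm_I, one_mul, ← ofReal_sub, norm_real, Real.norm_eq_abs]
      _ ≤ |ν - μ| * |μ|⁻¹ := by gcongr
      _ < 1 := by rwa [← div_eq_mul_inv, div_lt_one (abs_pos.2 hμ)]
  obtain ⟨u, hu⟩ := isUnit_one_sub_of_norm_lt_one hn
  intro y
  refine ⟨R ((↑u⁻¹ : E →L[ℂ] E) y), _, hR _, ?_⟩
  have h2 : (u : E →L[ℂ] E) ((↑u⁻¹ : E →L[ℂ] E) y) = y := by
    rw [← mul_apply_eq_comp, Units.mul_inv]; rfl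
  rw [hu] at h2
  simp only [_root_.sub_apply, one_apply_eq_self, _root_.smul_apply] at h2
  linear_combination (norm := module) h2

/-- For `μ² = 1`, `1 + S*S = (S - iμ)(S + iμ)`, so `S - iμ` has dense range; the lower bound and
closedness of `S` make the range closed. -/
theorem IsRegular.isSurjectiveAt_of_sq_eq_one (hS : IsSelfAdjoint A S) (hreg : IsRegular A S)
    {μ : ℝ} (hμ : μ * μ = 1) : IsSurjectiveAt S μ := by
  have hμ0 : μ ≠ 0 := by rintro rfl; simp at hμ
  have habs : |μ| = 1 := by
    have := abs_mul_abs_self μ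
    rw [hμ] at this
    nlinarith [abs_nonneg μ]
  intro y
  obtain ⟨u, hu, huy⟩ := mem_closure_iff_seq_limit.1 (hreg.dense_range y)
  have h1 : ∀ n, ∃ x s, (x, s) ∈ S.graph ∧ s - (I * μ) • x = u n := by
    intro n
    obtain ⟨⟨w, _, hw⟩, hu'⟩ := hu n
    have hw' := hw
    rw [hS.adjoint_eq] at hw'
    obtain ⟨hw1, hw2⟩ := mem_pcomp_domain.1 hw'
    have hval : u n = w + S ⟨S ⟨w, hw1⟩, hw2⟩ := by
      rw [← hu']
      change w + pcomp (adjoint A S) S ⟨w, hw⟩ = _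
      congr 1
      -- The domain proof depends on `adjoint A S`, so the operator is generalized before
      -- substituting `S`.
      have : ∀ (Q : E →ₗ.[ℂ] E) (hQ : Q = S) (h : w ∈ (pcomp Q S).domain),
          pcomp Q S ⟨w, h⟩ = S ⟨S ⟨w, hw1⟩, hw2⟩ := by
        rintro Q rfl h
        rfl
      exact this _ hS.adjoint_eq hw
    refine ⟨S ⟨w, hw1⟩ + (I * μ) • w, S ⟨S ⟨w, hw1⟩, hw2⟩ + (I * μ) • S ⟨w, hw1⟩,
      S.graph.add_mem (S.mem_graph ⟨_, hw2⟩) (S.graph.smul_mem _ (S.mem_graph ⟨w, hw1⟩)), ?_⟩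
    rw [hval]
    have h3 : (I * μ) * (I * μ) = -1 := by
      have : (μ : ℂ) * μ = 1 := by exact_mod_cast hμ
      linear_combination (μ : ℂ) * μ * I_mul_I - this
    linear_combination (norm := module) -h3 • w
  choose x s hx hxs using h1
  have hcau : CauchySeq u := huy.cauchySeq
  have hxc : CauchySeq x := by
    rw [Metric.cauchySeq_iff] at hcau ⊢
    intro ε hε
    obtain ⟨N, hN⟩ := hcau ε hε
    refine ⟨N, fun m hm n hn => lt_of_le_of_lt ?_ (hN m hm n hn)⟩
    have h2 : (x m - x n, s m - s n) ∈ S.graph := S.graph.sub_mem (hx m) (hx n)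
    have h4 := hS.norm_le h2 μ
    rw [habs, one_mul] at h4
    rw [dist_eq_norm, dist_eq_norm, ← hxs, ← hxs]
    refine h4.trans_eq (congrArg _ ?_)
    module
  obtain ⟨x₀, hx₀⟩ := cauchySeq_tendsto_of_complete hxc
  have hs₀ : Tendsto s atTop (𝓝 (y + (I * μ) • x₀)) := by
    refine (huy.add (hx₀.const_smul (I * (μ : ℂ)))).congr fun n => ?_
    rw [← hxs]
    module
  refine ⟨x₀, y + (I * μ) • x₀, ?_, by module⟩
  exact hS.isClosed.mem_of_tendsto (hx₀.prodMk_nhds hs₀) (Eventually.of_forall hx)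

theorem IsRegular.isSurjectiveAt (hS : IsSelfAdjoint A S) (hreg : IsRegular A S)
    {μ : ℝ} (hμ : μ ≠ 0) : IsSurjectiveAt S μ := by
  have key : ∀ n : ℕ, ∀ μ : ℝ, μ ≠ 0 → |μ| ≤ (3 / 2) ^ n → IsSurjectiveAt S μ := by
    intro n
    induction n with
    | zero =>
      intro μ hμ h
      rw [pow_zero] at h
      rcases lt_or_gt_of_ne hμ with h0 | h0
      · refine hS.isSurjectiveAt_of_abs_sub_lt (μ := -1) (by norm_num)
          (IsRegular.isSurjectiveAt_of_sq_eq_one hS hreg (by norm_num)) ?_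
        rw [abs_le] at h
        rw [abs_neg, abs_one, abs_lt]
        constructor <;> linarith
      · refine hS.isSurjectiveAt_of_abs_sub_lt (μ := 1) (by norm_num)
          (IsRegular.isSurjectiveAt_of_sq_eq_one hS hreg (by norm_num)) ?_
        rw [abs_le] at h
        rw [abs_one, abs_lt]
        constructor <;> linarith
    | succ n ih =>
      intro μ hμ h
      have hpos := abs_pos.2 hμ
      -- Any factor strictly between `1/2` and `1` works: the Neumann radius at a point equals its
      -- distance to `0`.
      refine hS.isSurjectiveAt_of_abs_sub_lt (μ := 2 / 3 * μ) (by positivity)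
        (ih _ (by positivity) ?_) ?_
      · rw [abs_mul, abs_of_pos (by norm_num : (0 : ℝ) < 2 / 3)]
        rw [pow_succ] at h
        linarith
      · rw [show μ - 2 / 3 * μ = 1 / 3 * μ by ring, abs_mul, abs_mul,
          abs_of_pos (by norm_num : (0 : ℝ) < 2 / 3), abs_of_pos (by norm_num : (0 : ℝ) < 1 / 3)]
        linarith
  obtain ⟨n, hn⟩ := pow_unbounded_of_one_lt |μ| (by norm_num : (1 : ℝ) < 3 / 2)
  exact key n μ hμ hn.le

theorem IsRegular.exists_isResolventFamily (hS : IsSelfAdjoint A S) (hreg : IsRegular A S) :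
    ∃ R, IsResolventFamily S R := by
  have h : ∀ μ : ℝ, ∃ R : E →L[ℂ] E, μ ≠ 0 → ∀ x, (R x, x + (I * μ) • R x) ∈ S.graph := by
    intro μ
    by_cases hμ : μ = 0
    · exact ⟨0, fun h => absurd hμ h⟩
    · obtain ⟨R, hR, -⟩ := hS.exists_rightInverse hμ (hreg.isSurjectiveAt hS hμ)
      exact ⟨R, fun _ => hR⟩
  choose R hR using h
  exact ⟨R, hR⟩

end Existence

end SelfAdjoint

/-! ### Graphs of sums, multiples, compositions and restrictions -/

section Graph

variable {E : Type*} [AddCommGroup E] [Module ℂ E] {f g : E →ₗ.[ℂ] E} {x y z : E}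

theorem mem_graph_pcomp (hf : (x, y) ∈ f.graph) (hg : (y, z) ∈ g.graph) :
    (x, z) ∈ (pcomp g f).graph := by
  obtain ⟨⟨x, hx⟩, rfl, rfl⟩ := (LinearPMap.mem_graph_iff f).1 hf
  obtain ⟨⟨w, hw⟩, h, rfl⟩ := (LinearPMap.mem_graph_iff g).1 hg
  simp only at h
  subst h
  exact (pcomp g f).mem_graph ⟨x, mem_pcomp_domain.2 ⟨hx, hw⟩⟩

theorem mem_graph_add_iff {s : E} :
    (x, s) ∈ (f + g).graph ↔ ∃ y z, (x, y) ∈ f.graph ∧ (x, z) ∈ g.graph ∧ s = y + z := by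
  constructor
  · intro h
    obtain ⟨⟨x, hx⟩, rfl, rfl⟩ := (LinearPMap.mem_graph_iff _).1 h
    exact ⟨_, _, f.mem_graph ⟨x, hx.1⟩, g.mem_graph ⟨x, hx.2⟩, rfl⟩
  · rintro ⟨y, z, hf, hg, rfl⟩
    obtain ⟨⟨x, hx⟩, rfl, rfl⟩ := (LinearPMap.mem_graph_iff f).1 hf
    obtain ⟨⟨w, hw⟩, h, rfl⟩ := (LinearPMap.mem_graph_iff g).1 hg
    subst h
    exact (f + g).mem_graph ⟨w, hx, hw⟩

theorem mem_graph_smul {c : ℂ} (hf : (x, y) ∈ f.graph) : (x, c • y) ∈ (c • f).graph := by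
  obtain ⟨⟨x, hx⟩, rfl, rfl⟩ := (LinearPMap.mem_graph_iff f).1 hf
  exact (c • f).mem_graph ⟨x, hx⟩

theorem mem_graph_add_smul_iff {c : ℂ} {s : E} :
    (x, s) ∈ (f + c • g).graph ↔
      ∃ y z, (x, y) ∈ f.graph ∧ (x, z) ∈ g.graph ∧ s = y + c • z := by
  rw [mem_graph_add_iff]
  constructor
  · rintro ⟨y, z, hf, hg, rfl⟩
    obtain ⟨⟨x, hx⟩, rfl, rfl⟩ := (LinearPMap.mem_graph_iff _).1 hg
    exact ⟨y, _, hf, g.mem_graph ⟨x, hx⟩, rfl⟩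
  · rintro ⟨y, z, hf, hg, rfl⟩
    exact ⟨y, _, hf, mem_graph_smul hg, rfl⟩

theorem mem_graph_sub (hf : (x, y) ∈ f.graph) (hg : (x, z) ∈ g.graph) :
    (x, y - z) ∈ (f - g).graph := by
  obtain ⟨⟨x, hx⟩, rfl, rfl⟩ := (LinearPMap.mem_graph_iff f).1 hf
  obtain ⟨⟨w, hw⟩, h, rfl⟩ := (LinearPMap.mem_graph_iff g).1 hg
  subst h
  exact (f - g).mem_graph ⟨w, hx, hw⟩

theorem mem_graph_domRestrict {p : Submodule ℂ E} (hf : (x, y) ∈ f.graph) (hx : x ∈ p) :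
    (x, y) ∈ (f.domRestrict p).graph := by
  obtain ⟨⟨x, hx'⟩, rfl, rfl⟩ := (LinearPMap.mem_graph_iff f).1 hf
  exact (f.domRestrict p).mem_graph ⟨x, hx, hx'⟩

end Graph

/-! ### The bounded operators `X μ` and their dependence on `μ` -/

section Commutator

variable {A : Type*} [NonUnitalCStarAlgebra A] [PartialOrder A] [StarOrderedRing A]
variable {E : Type*} [NormedAddCommGroup E] [NormedSpace ℂ E] [SMul A E] [CStarModule A E]
variable {S T : E →ₗ.[ℂ] E} {R X : ℝ → E →L[ℂ] E}

/-- The resolvents `R μ` preserve `dom T`, with `T (R μ) x = R μ (T x + X μ x)`; thus `X μ` extends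
the operator `[S, T] (R μ)`. -/
def IsCommutatorFamily (T : E →ₗ.[ℂ] E) (R X : ℝ → E →L[ℂ] E) : Prop :=
  ∀ μ : ℝ, μ ≠ 0 → ∀ x t, (x, t) ∈ T.graph → (R μ x, R μ (t + X μ x)) ∈ T.graph

/-- For `x ∈ 𝓔 ∩ dom T`, `(S - iμ) T (R μ) x = T (S - iμ)(R μ) x + [S, T](R μ) x = T x + X x`; apply
`R μ`. The relation obtained is closed in `(x, T x)`, so the core property carries it to all of `dom
T`. -/
theorem CommutatorAssumption.exists_isCommutatorFamily {𝓔 : Submodule ℂ E}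
    (h : CommutatorAssumption A S T 𝓔) (hS : IsSelfAdjoint A S) (hT : IsSelfAdjoint A T)
    (hR : IsResolventFamily S R) : ∃ X, IsCommutatorFamily T R X := by
  have key : ∀ μ : ℝ, ∃ X : E →L[ℂ] E, μ ≠ 0 → ∀ x t, (x, t) ∈ T.graph →
      (R μ x, R μ (t + X x)) ∈ T.graph := by
    intro μ
    by_cases hμ : μ = 0
    · exact ⟨0, fun h => absurd hμ h⟩
    obtain ⟨X, -, hX⟩ := h.exists_bounded_extension μ hμ
    refine ⟨X, fun _ => ?_⟩
    have hcore : ∀ x t, (x, t) ∈ (T.domRestrict 𝓔).graph →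
        (R μ x, R μ (t + X x)) ∈ T.graph := by
      intro x t hxt
      have hx𝓔 : x ∈ 𝓔 := (LinearPMap.mem_domain_of_mem_graph hxt).1
      replace hxt := LinearPMap.le_graph_of_le LinearPMap.domRestrict_le hxt
      have hres : (x, R μ x) ∈ (resolvent S μ).graph := by
        rw [mem_resolvent_graph A hS hμ]
        have hg := hR μ hμ x
        obtain ⟨w, hw, hw'⟩ := (LinearPMap.mem_graph_iff S).1 hg
        simp only at hw hw'
        refine ⟨hw ▸ w.2, ?_⟩
        have hw2 : S ⟨R μ x, hw ▸ w.2⟩ = S w := congrArg S (Subtype.ext hw.symm)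
        rw [hw2, hw']
        module
      obtain ⟨v, hv, hv'⟩ := (LinearPMap.mem_graph_iff _).1 hres
      simp only at hv hv'
      obtain ⟨-, h1, h2⟩ := h.resolvent_mem μ hμ v (hv ▸ hx𝓔)
      rw [LinearPMap.mem_domain_iff] at h2
      obtain ⟨q, hq⟩ := h2
      have hRx := T.mem_graph ⟨_, h1⟩
      set w := T ⟨_, h1⟩
      simp only [hv'] at hRx
      have hST : (R μ x, q) ∈ (pcomp S T).graph := mem_graph_pcomp hRx hq
      have hTS : (R μ x, t + (I * μ) • w) ∈ (pcomp T S).graph :=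
        mem_graph_pcomp (hR μ hμ x) (T.graph.add_mem hxt (T.graph.smul_mem _ hRx))
      have hcomm : (x, q - (t + (I * μ) • w)) ∈
          ((pcomp (commutator S T) (resolvent S μ)).domRestrict 𝓔).graph :=
        mem_graph_domRestrict (mem_graph_pcomp hres (mem_graph_sub hST hTS)) hx𝓔
      obtain ⟨u, hu, hu'⟩ := (LinearPMap.mem_graph_iff _).1 (LinearPMap.le_graph_of_le hX hcomm)
      have hXx : X x = q - (t + (I * μ) • w) := by
        simp only at hu hu'
        rw [← hu, ← hu']
        rfl
      have hw : R μ (t + X x) = w := by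
        refine (congrArg (R μ) ?_).trans (hR.eq_of_mem_graph hS hμ hq)
        rw [hXx]
        module
      rwa [hw]
    have hclosable : (T.domRestrict 𝓔).IsClosable :=
      hT.isClosed.isClosable.leIsClosable LinearPMap.domRestrict_le
    have hgraph := hclosable.graph_closure_eq_closure_graph
    rw [h.hasCore.closure_eq] at hgraph
    intro x t hxt
    rw [← hgraph, ← SetLike.mem_coe, Submodule.topologicalClosure_coe] at hxt
    have hcl : IsClosed {p : E × E | (R μ p.1, R μ (p.2 + X p.1)) ∈ T.graph} :=
      IsClosed.preimage (f := fun p : E × E => (R μ p.1, R μ (p.2 + X p.1))) (by fun_prop)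
        hT.isClosed
    exact closure_minimal (fun p hp => hcore p.1 p.2 hp) hcl hxt
  choose X hX using key
  exact ⟨X, hX⟩

variable (hX : IsCommutatorFamily T R X) (hR : IsResolventFamily S R)
  (hS : IsSelfAdjoint A S) (hT : IsSelfAdjoint A T)
include hX hR hS hT

/-- For `x ∈ dom T`, compute `T (R ν) x` directly and through `R ν x = R μ (x + i(ν - μ) R ν x)`,
then cancel the injective `R μ`. -/
theorem IsCommutatorFamily.apply_eq {μ ν : ℝ} (hμ : μ ≠ 0) (hν : ν ≠ 0) (x : E) :
    X ν x = X μ (x + (I * (ν - μ)) • R ν x) := by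
  have hcl : IsClosed {x : E | X ν x = X μ (x + (I * (ν - μ)) • R ν x)} :=
    isClosed_eq (by fun_prop) (by fun_prop)
  refine hT.dense_domain.induction (P := fun x => X ν x = X μ (x + (I * (ν - μ)) • R ν x))
    (fun x hx => ?_) hcl x
  have h1 := hX ν hν _ _ (T.mem_graph ⟨x, hx⟩)
  set t := T ⟨x, hx⟩
  simp only at h1
  have h2 := hX μ hμ _ _ (T.graph.add_mem (T.mem_graph ⟨x, hx⟩)
    (T.graph.smul_mem (I * (ν - μ)) h1))
  simp only [Prod.smul_mk] at h2
  rw [hR.apply_add hS hμ hν] at h2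
  have h3 := T.mem_graph_snd_inj h1 h2 rfl
  have h4 := hR.injective hμ ((hR.apply_add hS hμ hν (t + X ν x)).trans h3)
  linear_combination (norm := module) h4

/-- By `apply_eq` with `μ = 1`, this is `X 1` applied to `(x + iν R ν x) - i R ν x`, and both terms
vanish in the limit. -/
theorem IsCommutatorFamily.tendsto_zero (x : E) :
    Tendsto (fun ν => X ν x) (Bornology.cobounded ℝ) (𝓝 0) := by
  have h1 := (hR.tendsto_add hS x).sub ((hR.tendsto_zero hS x).const_smul I)
  have h2 := ((X 1).continuous.tendsto _).comp h1
  simp only [smul_zero, sub_zero, map_zero] at h2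
  refine h2.congr' ?_
  filter_upwards [eventually_cobounded_ne_zero] with ν hν
  rw [hX.apply_eq hR hS hT one_ne_zero hν, Function.comp_apply]
  congr 1
  push_cast
  module

/-- On `dom T`, `R μ X μ = T (R μ) - (R μ) T`; taking adjoints reverses the products and replaces
`μ` by `-μ`, whence the sign. -/
theorem IsCommutatorFamily.inner_eq {μ : ℝ} (hμ : μ ≠ 0) (x y : E) :
    inner A (R μ (X μ x)) y = -inner A x (R (-μ) (X (-μ) y)) := by
  have hcl : IsClosed {p : E × E |
      inner A (R μ (X μ p.1)) p.2 = -inner A p.1 (R (-μ) (X (-μ) p.2))} := by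
    refine isClosed_eq ?_ (Continuous.neg ?_)
    · exact CStarModule.continuous_inner.comp
        (((R μ).continuous.comp ((X μ).continuous.comp continuous_fst)).prodMk continuous_snd)
    · exact CStarModule.continuous_inner.comp
        (continuous_fst.prodMk ((R _).continuous.comp ((X _).continuous.comp continuous_snd)))
  refine (hT.dense_domain.prod hT.dense_domain).induction
    (P := fun p : E × E => inner A (R μ (X μ p.1)) p.2 = -inner A p.1 (R (-μ) (X (-μ) p.2)))
    ?_ hcl (x, y)
  rintro ⟨x, y⟩ ⟨hx, hy⟩
  have hμ' : -μ ≠ 0 := neg_ne_zero.2 hμ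
  have gx := T.mem_graph ⟨x, hx⟩
  have gy := T.mem_graph ⟨y, hy⟩
  have h1 := hT.symm (hX μ hμ _ _ gx) gy
  have h2 := hT.symm gx (hX (-μ) hμ' _ _ gy)
  simp only [map_add, CStarModule.inner_add_left, CStarModule.inner_add_right,
    hR.inner_eq hS hμ (T ⟨x, hx⟩), hR.inner_eq hS hμ x] at h1 h2
  simp only
  linear_combination (norm := module) h1 - h2

end Commutator

/-! ### The operators `S + cT` with `c = ±i` -/

section Sum

variable {A : Type*} [NonUnitalCStarAlgebra A] [PartialOrder A] [StarOrderedRing A]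
variable {E : Type*} [NormedAddCommGroup E] [NormedSpace ℂ E] [SMul A E] [CStarModule A E]
variable {S T : E →ₗ.[ℂ] E} {R X : ℝ → E →L[ℂ] E}

variable (A) in
theorem tendsto_inner {α : Type*} {l : Filter α} {f g : α → E} {x y : E}
    (hf : Tendsto f l (𝓝 x)) (hg : Tendsto g l (𝓝 y)) :
    Tendsto (fun a => (inner A (f a) (g a) : A)) l (𝓝 (inner A x y)) :=
  (CStarModule.continuous_inner.tendsto (x, y)).comp (hf.prodMk_nhds hg)

variable (hX : IsCommutatorFamily T R X) (hR : IsResolventFamily S R)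
  (hS : IsSelfAdjoint A S) (hT : IsSelfAdjoint A T)
include hX hR hS hT

/-- When `(S - iμ)x ∈ dom T`, writing `x = R μ (S - iμ)x` shows `Tx ∈ dom S`, so `S` and `T` can
both be moved across the inner product. -/
theorem IsCommutatorFamily.inner_sub_of_mem_graph {μ : ℝ} (hμ : μ ≠ 0) {x s t τ : E}
    (hs : (x, s) ∈ S.graph) (ht : (x, t) ∈ T.graph) (hτ : (s - (I * μ) • x, τ) ∈ T.graph) :
    inner A s t - inner A t s = inner A x (X μ (s - (I * μ) • x)) := by
  have hx := hR.eq_of_mem_graph hS hμ hs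
  have h1 := hX μ hμ _ _ hτ
  rw [hx] at h1
  have h2 : t = R μ (τ + X μ (s - (I * μ) • x)) := T.mem_graph_snd_inj ht h1 rfl
  have h3 := hR μ hμ (τ + X μ (s - (I * μ) • x))
  rw [← h2] at h3
  have h4 := hS.symm hs h3
  have h5 := hT.symm ht hτ
  have h6 := hT.symm ht ht
  simp only [CStarModule.inner_add_right, CStarModule.inner_sub_right,
    CStarModule.inner_smul_right_complex] at h4 h5 ⊢
  simp only [map_sub, map_smul, CStarModule.inner_sub_right,
    CStarModule.inner_smul_right_complex] at h4 ⊢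
  linear_combination (norm := module) h4 - h5 - (I * (μ : ℂ)) • h6

/-- Replace `x` by `-iν R ν x`, to which the previous case applies, and let `|ν| → ∞`. Its image
under `T` is `-iν R ν (Tx + X ν x)`, which tends to `Tx` because `X ν x → 0`. -/
theorem IsCommutatorFamily.inner_sub {μ : ℝ} (hμ : μ ≠ 0) {x s t : E}
    (hs : (x, s) ∈ S.graph) (ht : (x, t) ∈ T.graph) :
    inner A s t - inner A t s = inner A x (X μ (s - (I * μ) • x)) := by
  have tx := hR.tendsto_smul hS x
  have ts := hR.tendsto_smul hS s
  have tt : Tendsto (fun ν : ℝ => (-(I * ν)) • R ν (t + X ν x)) (Bornology.cobounded ℝ) (𝓝 t) := by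
    have := (hR.tendsto_smul hS t).sub
      (hR.tendsto_smul_apply_zero hS (hX.tendsto_zero hR hS hT x))
    rw [sub_zero] at this
    refine this.congr fun ν => ?_
    rw [map_add]
    module
  have lhs := (tendsto_inner A ts tt).sub (tendsto_inner A tt ts)
  have rhs := tendsto_inner A tx
    (((X μ).continuous.tendsto _).comp (ts.sub (tx.const_smul (I * (μ : ℂ)))))
  refine tendsto_nhds_unique (lhs.congr' ?_) rhs
  filter_upwards [eventually_cobounded_ne_zero] with ν hν
  have e1 : R ν s = x + (I * ν) • R ν x := by
    have := hR.eq_of_mem_graph hS hν hs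
    rw [map_sub, map_smul] at this
    exact sub_eq_iff_eq_add.1 this
  have g1 := S.graph.smul_mem (-(I * ν)) (hR ν hν x)
  rw [← e1] at g1
  have h1 := hX ν hν _ _ ht
  have g2 := T.graph.smul_mem (-(I * ν)) h1
  have g3 : (-(I * ν) • (x + (I * (ν - μ)) • R ν x),
      -(I * ν) • (t + (I * (ν - μ)) • R ν (t + X ν x))) ∈ T.graph :=
    T.graph.smul_mem (-(I * ν)) (T.graph.add_mem ht (T.graph.smul_mem (I * (ν - μ)) h1))
  refine hX.inner_sub_of_mem_graph hR hS hT hμ g1 g2 ?_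
    (τ := -(I * ν) • (t + (I * (ν - μ)) • R ν (t + X ν x)))
  convert g3 using 2
  rw [e1]
  module

/-- The conditions on `c` treat `i` and `-i` together. Expanding the square, `⟨s, s⟩ + ⟨t, t⟩`
differs from `⟨s + ct, s + ct⟩` by `c⟨x, X 1 (s - ix)⟩`, which is only linear in `s`; the term `⟨t,
t⟩ ≥ 0` is dropped. -/
theorem IsCommutatorFamily.norm_le {c : ℂ} (hc : star c = -c) (hc' : c * c = -1) {x s t : E}
    (hs : (x, s) ∈ S.graph) (ht : (x, t) ∈ T.graph) :
    ‖s‖ ≤ ‖s + c • t‖ + (‖X 1‖ + 1) * ‖x‖ := by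
  have hcn : ‖c‖ = 1 := by
    have := congrArg norm hc'
    rw [norm_mul, norm_neg, norm_one] at this
    nlinarith [norm_nonneg c]
  have h1 := hX.inner_sub hR hS hT one_ne_zero hs ht
  rw [ofReal_one, mul_one] at h1
  set w := X 1 (s - I • x) with hw
  have h2 : inner A s s + inner A t t = inner A (s + c • t) (s + c • t) - c • inner A x w := by
    simp only [CStarModule.inner_add_left, CStarModule.inner_add_right,
      CStarModule.inner_smul_left_complex, CStarModule.inner_smul_right_complex, hc, ← h1]
    linear_combination (norm := module) hc' • inner A t t
  have h3 : ‖s‖ ^ 2 ≤ ‖s + c • t‖ ^ 2 + ‖x‖ * ‖w‖ := by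
    rw [CStarModule.norm_sq_eq A (x := s), CStarModule.norm_sq_eq A (x := s + c • t)]
    calc ‖inner A s s‖ ≤ ‖inner A s s + inner A t t‖ :=
          CStarAlgebra.norm_le_norm_of_nonneg_of_le CStarModule.inner_self_nonneg
            (le_add_of_nonneg_right CStarModule.inner_self_nonneg)
      _ ≤ _ := by
          rw [h2]
          refine (norm_sub_le _ _).trans ?_
          rw [norm_smul, hcn, one_mul]
          gcongr
          exact CStarModule.norm_inner_le E
  have h4 : ‖w‖ ≤ ‖X 1‖ * (‖s‖ + ‖x‖) := by
    refine ((X 1).le_opNorm _).trans ?_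
    gcongr
    refine (norm_sub_le _ _).trans ?_
    rw [norm_smul, norm_I, one_mul]
  -- Multiply the negation by `‖s‖`. The `+ 1` in the constant gives a term `‖x‖‖s‖`, which absorbs
  -- `‖X 1‖‖x‖²` since `‖s‖ ≥ ‖X 1‖‖x‖`.
  by_contra! h5
  have n1 := norm_nonneg x
  have n2 := norm_nonneg (s + c • t)
  have n3 := norm_nonneg (X 1)
  have n4 := norm_nonneg s
  have h6 : ‖x‖ * ‖w‖ ≤ ‖x‖ * (‖X 1‖ * (‖s‖ + ‖x‖)) := by gcongr
  have n5 : 0 ≤ ‖X 1‖ * ‖x‖ := by positivity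
  have hs1 : ‖s + c • t‖ ≤ ‖s‖ := by linarith
  have hs2 : ‖X 1‖ * ‖x‖ ≤ ‖s‖ := by linarith
  have hs3 : 0 < ‖s‖ := by linarith
  have k1 : ‖s + c • t‖ * ‖s + c • t‖ ≤ ‖s‖ * ‖s + c • t‖ := by gcongr
  have k2 : ‖x‖ * (‖X 1‖ * ‖x‖) ≤ ‖x‖ * ‖s‖ := by gcongr
  have k3 := mul_lt_mul_of_pos_left h5 hs3
  linarith

theorem IsCommutatorFamily.dense_domain (c : ℂ) : Dense ((S + c • T).domain : Set E) := by
  refine (hR.dense_image hS one_ne_zero hT.dense_domain).mono ?_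
  rintro _ ⟨x, hx, rfl⟩
  exact ⟨LinearPMap.mem_domain_of_mem_graph (hR 1 one_ne_zero x),
    show R 1 x ∈ T.domain from LinearPMap.mem_domain_of_mem_graph (hX 1 one_ne_zero _ _ (T.mem_graph ⟨x, hx⟩))⟩

theorem IsCommutatorFamily.isClosed [CompleteSpace E] {c : ℂ} (hc : star c = -c)
    (hc' : c * c = -1) : (S + c • T).IsClosed := by
  refine IsSeqClosed.isClosed ?_
  rintro p ⟨x, f⟩ hp hlim
  have hx : Tendsto (fun n => (p n).1) atTop (𝓝 x) := hlim.fst_nhds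
  have hf : Tendsto (fun n => (p n).2) atTop (𝓝 f) := hlim.snd_nhds
  choose s t hs ht hst using fun n => mem_graph_add_smul_iff.1 (hp n)
  have hsc : CauchySeq s := by
    have hxc := cauchySeq_iff_tendsto_dist_atTop_0.1 hx.cauchySeq
    have hfc := cauchySeq_iff_tendsto_dist_atTop_0.1 hf.cauchySeq
    have hlim0 := hfc.add (hxc.const_mul (‖X 1‖ + 1))
    rw [mul_zero, add_zero] at hlim0
    refine cauchySeq_iff_tendsto_dist_atTop_0.2 (squeeze_zero (fun _ => dist_nonneg) ?_ hlim0)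
    rintro ⟨m, n⟩
    have hsub : ((p m).1 - (p n).1, s m - s n) ∈ S.graph := S.graph.sub_mem (hs m) (hs n)
    have hsub_t : ((p m).1 - (p n).1, t m - t n) ∈ T.graph := T.graph.sub_mem (ht m) (ht n)
    have h := hX.norm_le hR hS hT hc hc' hsub hsub_t
    simp only [dist_eq_norm, hst]
    rwa [show (s m + c • t m) - (s n + c • t n) = s m - s n + c • (t m - t n) by module]
  obtain ⟨s₀, hs₀⟩ := cauchySeq_tendsto_of_complete hsc
  have ht₀ : Tendsto t atTop (𝓝 (-c • (f - s₀))) := by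
    refine ((hf.sub hs₀).const_smul (-c)).congr fun n => ?_
    rw [hst]
    linear_combination (norm := module) -hc' • t n
  refine mem_graph_add_smul_iff.2 ⟨s₀, -c • (f - s₀),
    hS.isClosed.mem_of_tendsto (hx.prodMk_nhds hs₀) (Eventually.of_forall hs),
    hT.isClosed.mem_of_tendsto (hx.prodMk_nhds ht₀) (Eventually.of_forall ht), ?_⟩
  linear_combination (norm := module) hc' • (f - s₀)

/-- Test the adjoint relation on `R (-ρ) x` with `x ∈ dom T` and move every bounded operator to the
right: what remains says that `R ρ y ∈ dom T*`, and `T* = T`. -/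
theorem IsCommutatorFamily.resolvent_mem_graph {c : ℂ} (hc : star c = -c) (hc' : c * c = -1)
    {y z : E} (h : (y, z) ∈ adjointGraph A (S + c • T)) {ρ : ℝ} (hρ : ρ ≠ 0) :
    (R ρ y, c • (R ρ z - (y + (I * ρ) • R ρ y)) + R ρ (X ρ y)) ∈ T.graph := by
  rw [hT.mem_graph_iff]
  intro x t hxt
  have hρ' : -ρ ≠ 0 := neg_ne_zero.2 hρ
  have h1 := mem_adjointGraph_iff.1 h _ _ (mem_graph_add_smul_iff.2
    ⟨_, _, hR (-ρ) hρ' x, hX (-ρ) hρ' _ _ hxt, rfl⟩)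
  simp only [map_add, CStarModule.inner_add_left, CStarModule.inner_smul_left_complex,
    hX.inner_eq hR hS hT hρ', hR.inner_eq hS hρ', neg_neg, hc] at h1
  simp only [CStarModule.inner_add_right, CStarModule.inner_sub_right,
    CStarModule.inner_smul_right_complex]
  simp only [star_mul', RCLike.star_def, conj_I, map_neg, conj_ofReal, ofReal_neg] at h1
  linear_combination (norm := module) c • h1 + hc' • (inner A t (R ρ y) - inner A x (R ρ (X ρ y)))

/-- For `y` in the adjoint domain, `c² = -1` cancels the `S (R ρ) y` terms and leaves `(S - cT)(-iρ
R ρ y) = -iρ R ρ z + c iρ R ρ X ρ y`, which tends to `z`. Closedness of `S - cT` concludes; the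
other inclusion is symmetry. -/
theorem IsCommutatorFamily.adjoint_add_smul [CompleteSpace E] {c : ℂ} (hc : star c = -c)
    (hc' : c * c = -1) : adjoint A (S + c • T) = S + (-c) • T := by
  refine LinearPMap.eq_of_eq_graph ?_
  rw [adjoint_graph A (hX.dense_domain hR hS hT c)]
  ext ⟨y, z⟩
  constructor
  · intro h
    have h1 := (hR.tendsto_smul hS z).add
      ((hR.tendsto_smul_apply_zero hS (hX.tendsto_zero hR hS hT y)).const_smul c)
    rw [smul_zero, add_zero] at h1
    refine (hX.isClosed hR hS hT (c := -c) (by rw [star_neg, hc]) (by rw [neg_mul_neg, hc']))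
      |>.mem_of_tendsto ((hR.tendsto_smul hS y).prodMk_nhds h1) ?_
    filter_upwards [eventually_cobounded_ne_zero] with ρ hρ
    refine mem_graph_add_smul_iff.2 ⟨_, _, S.graph.smul_mem (-(I * ρ)) (hR ρ hρ y),
      T.graph.smul_mem (-(I * ρ)) (hX.resolvent_mem_graph hR hS hT hc hc' h hρ), ?_⟩
    simp only
    linear_combination (norm := module)
      -((I * ρ) * hc') • (R ρ z - (y + (I * (ρ : ℂ)) • R ρ y))
  · intro h
    obtain ⟨s, t, hs, ht, rfl⟩ := mem_graph_add_smul_iff.1 h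
    rw [mem_adjointGraph_iff]
    intro x f hf
    obtain ⟨s', t', hs', ht', rfl⟩ := mem_graph_add_smul_iff.1 hf
    simp only [CStarModule.inner_add_left, CStarModule.inner_add_right,
      CStarModule.inner_smul_left_complex, CStarModule.inner_smul_right_complex, hc,
      hS.symm hs' hs, hT.symm ht' ht]

end Sum

/-! ### Off-diagonal operator matrices on `E ⊕ E` -/

section OffDiagonal

variable {A : Type*} {E : Type*} [NormedAddCommGroup E] [NormedSpace ℂ E] {P Q : E →ₗ.[ℂ] E}

theorem mem_graph_offDiagonal_iff {x y : C⋆ᵐᵒᵈ(A, E × E)} :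
    (x, y) ∈ (offDiagonal A P Q).graph ↔ (x.1, y.2) ∈ Q.graph ∧ (x.2, y.1) ∈ P.graph := by
  constructor
  · intro h
    obtain ⟨w, rfl, rfl⟩ := (LinearPMap.mem_graph_iff _).1 h
    exact ⟨Q.mem_graph ⟨_, w.2.1⟩, P.mem_graph ⟨_, w.2.2⟩⟩
  · rintro ⟨h1, h2⟩
    obtain ⟨u, hu, hu'⟩ := (LinearPMap.mem_graph_iff _).1 h1
    obtain ⟨v, hv, hv'⟩ := (LinearPMap.mem_graph_iff _).1 h2
    obtain ⟨u, hu₀⟩ := u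
    obtain ⟨v, hv₀⟩ := v
    obtain ⟨x₁, x₂⟩ := x
    obtain ⟨y₁, y₂⟩ := y
    change u = x₁ at hu
    change v = x₂ at hv
    change Q ⟨u, hu₀⟩ = y₂ at hu'
    change P ⟨v, hv₀⟩ = y₁ at hv'
    subst hu hv hu' hv'
    exact (offDiagonal A P Q).mem_graph ⟨(u, v), hu₀, hv₀⟩

theorem dense_domain_offDiagonal (hP : Dense (P.domain : Set E)) (hQ : Dense (Q.domain : Set E)) :
    Dense ((offDiagonal A P Q).domain : Set C⋆ᵐᵒᵈ(A, E × E)) :=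
  (hQ.prod hP).preimage
    (WithCStarModule.uniformEquiv (A := A) (E := E × E)).toHomeomorph.isOpenMap

variable [NonUnitalCStarAlgebra A] [PartialOrder A] [StarOrderedRing A] [SMul A E] [CStarModule A E]

/-- Testing on vectors supported in one summand decouples the adjoint relation into one for `P` and
one for `Q`. -/
theorem adjoint_offDiagonal (hP : Dense (P.domain : Set E)) (hQ : Dense (Q.domain : Set E)) :
    adjoint A (offDiagonal A P Q) = offDiagonal A (adjoint A Q) (adjoint A P) := by
  refine LinearPMap.eq_of_eq_graph ?_
  rw [adjoint_graph A (dense_domain_offDiagonal hP hQ)]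
  ext ⟨y, z⟩
  rw [mem_graph_offDiagonal_iff, adjoint_graph A hP, adjoint_graph A hQ]
  simp only [mem_adjointGraph_iff]
  constructor
  · intro h
    constructor
    · intro x t hxt
      have := h ((WithCStarModule.equiv A (E × E)).symm (0, x))
        ((WithCStarModule.equiv A (E × E)).symm (t, 0))
        (mem_graph_offDiagonal_iff.2 ⟨Q.graph.zero_mem, hxt⟩)
      simpa [WithCStarModule.prod_inner] using this
    · intro x t hxt
      have := h ((WithCStarModule.equiv A (E × E)).symm (x, 0))
        ((WithCStarModule.equiv A (E × E)).symm (0, t))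
        (mem_graph_offDiagonal_iff.2 ⟨hxt, P.graph.zero_mem⟩)
      simpa [WithCStarModule.prod_inner] using this
  · rintro ⟨h1, h2⟩ x t hxt
    obtain ⟨g1, g2⟩ := mem_graph_offDiagonal_iff.1 hxt
    rw [WithCStarModule.prod_inner, WithCStarModule.prod_inner, h1 _ _ g2, h2 _ _ g1, add_comm]

end OffDiagonal

end HilbertModuleOp

theorem mainTheorem4
    {A : Type*} [NonUnitalCStarAlgebra A] [PartialOrder A] [StarOrderedRing A]
    {E : Type*} [NormedAddCommGroup E] [NormedSpace ℂ E] [SMul A E] [CStarModule A E]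
    [CompleteSpace E]
    (S T : E →ₗ.[ℂ] E)
    (hS : HilbertModuleOp.IsSelfAdjoint A S) (hSreg : HilbertModuleOp.IsRegular A S)
    (hT : HilbertModuleOp.IsSelfAdjoint A T) (hTreg : HilbertModuleOp.IsRegular A T)
    (𝓔 : Submodule ℂ E) (h𝓔 : HilbertModuleOp.CommutatorAssumption A S T 𝓔) :
    (HilbertModuleOp.IsSemiregular A (S + Complex.I • T) ∧
      HilbertModuleOp.IsSemiregular A (S - Complex.I • T)) ∧
    ((S + Complex.I • T).IsClosed ∧ (S - Complex.I • T).IsClosed) ∧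
    (HilbertModuleOp.adjoint A (S + Complex.I • T) = S - Complex.I • T ∧
      HilbertModuleOp.adjoint A (S - Complex.I • T) = S + Complex.I • T) ∧
    HilbertModuleOp.IsSelfAdjoint A (HilbertModuleOp.sumOperator A S T) := by
  have hI : star Complex.I = -Complex.I := by simp
  have hI' : star (-Complex.I) = -(-Complex.I) := by simp
  have hII : Complex.I * Complex.I = -1 := Complex.I_mul_I
  have hII' : -Complex.I * -Complex.I = -1 := by rw [neg_mul_neg, hII]
  have hsub : S - Complex.I • T = S + (-Complex.I) • T := by
    rw [sub_eq_add_neg]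
    congr 1
    exact LinearPMap.ext rfl fun x _ _ => (neg_smul _ _).symm
  obtain ⟨R, hR⟩ := hSreg.exists_isResolventFamily hS
  obtain ⟨X, hX⟩ := h𝓔.exists_isCommutatorFamily hS hT hR
  have hadj : HilbertModuleOp.adjoint A (S + Complex.I • T) = S - Complex.I • T := by
    rw [hsub]
    exact hX.adjoint_add_smul hR hS hT hI hII
  have hadj' : HilbertModuleOp.adjoint A (S - Complex.I • T) = S + Complex.I • T := by
    rw [hsub, hX.adjoint_add_smul hR hS hT hI' hII', neg_neg]
  have hd := hX.dense_domain hR hS hT Complex.I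
  -- Both domains are `dom S ∩ dom T` by definition.
  have hd' : Dense ((S - Complex.I • T).domain : Set E) := hd
  refine ⟨⟨⟨?_, hd, ?_⟩, ⟨?_, hd', ?_⟩⟩, ⟨hX.isClosed hR hS hT hI hII, ?_⟩, ⟨hadj, hadj'⟩,
    HilbertModuleOp.dense_domain_offDiagonal hd' hd, ?_⟩
  · exact fun a x hx => ⟨hSreg.smul_mem a x hx.1, hTreg.smul_mem a x hx.2⟩
  · rwa [hadj]
  · exact fun a x hx => ⟨hSreg.smul_mem a x hx.1, hTreg.smul_mem a x hx.2⟩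
  · rwa [hadj']
  · rw [hsub]
    exact hX.isClosed hR hS hT hI' hII'
  · rw [HilbertModuleOp.sumOperator, HilbertModuleOp.adjoint_offDiagonal hd' hd, hadj, hadj']
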